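/- Let $1\le p\le\infty$, let $E$ be a real Banach space and $X$ a real Banach lattice. "Operator" means bounded linear operator, $B_Y$ is the closed unit ball of $Y$, and $(\sum_i a_i^p)^{1/p}$ means $\max_i a_i$ when $p=\infty$. An operator $T$ from a Banach space $F$ to a Banach lattice is $(p,\infty)$-convex with constant $K$ if $\big\|\bigvee_{i=1}^n|Tx_i|\big\|\le K\big(\sum_{i=1}^n\|x_i\|^p\big)^{1/p}$ for all $n\ge 1$ and $x_1,\dots,x_n\in F$. An operator $T$ from a Banach lattice $Z$ to a Banach space is $(p,1)$-concave with constant $K$ if $\big(\sum_{i=1}^n\|Tx_i\|^p\big)^{1/p}\le K\big\|\sum_{i=1}^n|x_i|\big\|$ for all $n\ge1$ and $x_1,\dots,x_n\in Z$. $T$ is $(p,\infty)$-convex (respectively $(p,1)$-concave) if it is so with some constant $K\ge1$. A Banach lattice has one of these properties (with constant $K$) if its identity operator does. An operator $V$ between Banach lattices $Y$ and $Z$ is of Class $\mathcal C$ if it is an injective lattice homomorphism that is interval preserving (i.e. positive with $V[0,y]=[0,Vy]$ for all $y\ge0$) and $V(B_Y)$ is closed in $Z$. It is of Class $\mathcal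 D$ if it is a lattice homomorphism with dense range. 1. Let $T:E\to X$ be a $(p,\infty)$-convex operator. There exist a Banach lattice $Y_0$ that is $(p,\infty)$-convex with constant $1$ and operators $U_0:E\to Y_0$ and $V_0:Y_0\to X$ such that $V_0$ is of Class $\mathcal C$ and $T=V_0U_0$. Moreover, whenever $Y$ is a $(p,\infty)$-convex Banach lattice and $U:E\to Y$, $V:Y\to X$ are operators such that $V$ is of Class $\mathcal C$ and $T=VU$, there is a Class $\mathcal C$ operator $\phi:Y_0\to Y$ with $U=\phi U_0$ and $V_0=V\phi$. 2. Let $T:X\to E$ be a $(p,1)$-concave operator. There exist a Banach lattice $Y^0$ that is $(p,1)$-concave with constant $1$ and operators $U^0:X\to Y^0$ and $V^0:Y^0\to E$ such that $U^0$ is of Class $\mathcal D$ and $T=V^0U^0$. Moreover, whenever $Y$ is a $(p,1)$-concave Banach lattice and $U:X\to Y$, $V:Y\to E$ are operators such that $U$ is of Class $\mathcal D$ and $T=VU$, there is a Class $\mathcal D$ operator $\phi:Y\to Y^0$ with $U^0=\phi U$ and $V^0\phi=V$. -/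

import Mathlib

open scoped ENNReal

universe u v w

/-- A (real) Banach lattice: a complete normed real vector lattice whose norm is a lattice norm,
i.e. `|x| ≤ |y|` implies `‖x‖ ≤ ‖y‖` (`HasSolidNorm`). -/
class IsBanachLattice (X : Type*) [NormedAddCommGroup X] [Lattice X] [NormedSpace ℝ X] : Prop
    extends HasSolidNorm X, IsOrderedAddMonoid X, IsOrderedModule ℝ X, CompleteSpace X

/-- The `ℓ_p`-norm of a finite real sequence: `(∑ i, |a i| ^ p) ^ (1 / p)` for `1 ≤ p < ∞` and
`max |a i|` for `p = ∞`. -/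
noncomputable def ellNorm (p : ℝ≥0∞) {n : ℕ} (a : Fin n → ℝ) : ℝ :=
  ‖(WithLp.toLp p a : PiLp p (fun _ : Fin n => ℝ))‖

section Convexity

variable {E X : Type*} [NormedAddCommGroup E] [NormedSpace ℝ E]
  [NormedAddCommGroup X] [Lattice X] [NormedSpace ℝ X]

/-- `T : E → X` is `(p,∞)`-convex with constant `K`: for every nonempty finite sequence `x` in `E`,
`‖⋁ i, |T (x i)|‖ ≤ K (∑ i, ‖x i‖ ^ p) ^ (1 / p)`. -/
def IsPInftyConvexWith (p : ℝ≥0∞) (K : ℝ) (T : E →L[ℝ] X) : Prop :=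
  ∀ (n : ℕ) (x : Fin (n + 1) → E),
    ‖Finset.univ.sup' Finset.univ_nonempty (fun i => |T (x i)|)‖ ≤ K * ellNorm p (fun i => ‖x i‖)

/-- `T : E → X` is `(p,∞)`-convex. -/
def IsPInftyConvex (p : ℝ≥0∞) (T : E →L[ℝ] X) : Prop :=
  ∃ K : ℝ, 1 ≤ K ∧ IsPInftyConvexWith p K T

/-- `T : X → E` is `(p,1)`-concave with constant `K`: for every nonempty finite sequence `x` in `X`,
`(∑ i, ‖T (x i)‖ ^ p) ^ (1 / p) ≤ K ‖∑ i, |x i|‖`. -/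
def IsPOneConcaveWith (p : ℝ≥0∞) (K : ℝ) (T : X →L[ℝ] E) : Prop :=
  ∀ (n : ℕ) (x : Fin (n + 1) → X),
    ellNorm p (fun i => ‖T (x i)‖) ≤ K * ‖∑ i, |x i|‖

/-- `T : X → E` is `(p,1)`-concave. -/
def IsPOneConcave (p : ℝ≥0∞) (T : X →L[ℝ] E) : Prop :=
  ∃ K : ℝ, 1 ≤ K ∧ IsPOneConcaveWith p K T

end Convexity

section Classes

variable {X Y : Type*} [NormedAddCommGroup X] [Lattice X] [NormedSpace ℝ X]
  [NormedAddCommGroup Y] [Lattice Y] [NormedSpace ℝ Y]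

/-- A bounded linear operator that preserves the lattice operations. -/
def IsLatticeHomomorphism (T : X →L[ℝ] Y) : Prop :=
  ∀ x y : X, T (x ⊔ y) = T x ⊔ T y ∧ T (x ⊓ y) = T x ⊓ T y

/-- A positive operator with `T [0, x] = [0, T x]` for all `x ≥ 0`. -/
def IsIntervalPreserving (T : X →L[ℝ] Y) : Prop :=
  (∀ x : X, 0 ≤ x → 0 ≤ T x) ∧ ∀ x : X, 0 ≤ x → T '' Set.Icc 0 x = Set.Icc 0 (T x)

/-- Class `𝒞`: injective, interval preserving lattice homomorphisms that map the closed unit ball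
onto a closed set. -/
structure IsClassC (T : X →L[ℝ] Y) : Prop where
  injective : Function.Injective T
  intervalPreserving : IsIntervalPreserving T
  latticeHomomorphism : IsLatticeHomomorphism T
  isClosed_image_ball : IsClosed (T '' Metric.closedBall (0 : X) 1)

/-- Class `𝒟`: lattice homomorphisms with dense range. -/
structure IsClassD (T : X →L[ℝ] Y) : Prop where
  latticeHomomorphism : IsLatticeHomomorphism T
  denseRange : DenseRange T

end Classes

/-! Part 1. A closed, bounded, convex, solid set in `X` is the unit ball of the order ideal it
spans, normed by its gauge, and the inclusion of that ideal is of Class `𝒞`. For `Y₀` take the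
smallest closed, convex, solid set `B` containing all `⋁ i, |T (x i)|` with `(‖x i‖)` in the unit
ball of `ℓ_p`; convexity of `T` makes `B` bounded. Because the `ℓ_p`-norm of a concatenated family
can be computed blockwise (`finLpNorm.sigma`), these suprema are, up to domination, stable under `⋁
i, |a i| • u i` with `a` in the unit ball of `ℓ_p`. The stability survives convex hull, solid hull
and closure (`pConvexDisc.sup'_mem`), and it says that `Y₀` has constant 1. If `T = VU` is another
factorization, then `V` maps a large ball of `Y` onto a closed, convex, solid set containing the
generators, hence `B`; so `φ = V⁻¹V₀` makes sense and is bounded (`IsClassC.exists_lift`).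

Part 2 is dual. Let `ρ x` be the supremum of the `ℓ_p`-norms of `(‖T (z i)‖)` over families with `∑
i, |z i| ≤ |x|`. It lies between `‖T x‖` and `K * ‖x‖`. Riesz decomposition gives the triangle
inequality, and concatenating nearly optimal families gives concavity with constant 1
(`pConcaveGauge.finLpNorm_gauge_le`). `Y⁰` is the Hausdorff completion of `(X, ρ)`. If `T = VU`,
then `ρ ≤ C * ‖U ·‖`, so `U x ↦ U⁰ x` is well defined and bounded on a dense subspace and extends to
`φ`. -/

open scoped Pointwise

/-! ### Finite `ℓ_p`-norms -/

/-- The `ℓ_p`-norm of a real family over an arbitrary finite index type. -/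
noncomputable def finLpNorm (p : ℝ≥0∞) {ι : Type*} [Fintype ι] (a : ι → ℝ) : ℝ :=
  ‖(WithLp.toLp p a : PiLp p (fun _ : ι => ℝ))‖

theorem ellNorm_eq_finLpNorm (p : ℝ≥0∞) {n : ℕ} (a : Fin n → ℝ) :
    ellNorm p a = finLpNorm p a := rfl

namespace finLpNorm

variable {p : ℝ≥0∞} [hp : Fact (1 ≤ p)] {ι κ : Type*} [Fintype ι] [Fintype κ]

theorem nonneg (a : ι → ℝ) : 0 ≤ finLpNorm p a :=
  norm_nonneg (WithLp.toLp p a : PiLp p (fun _ : ι => ℝ))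

theorem comp_equiv (e : ι ≃ κ) (a : κ → ℝ) : finLpNorm p (a ∘ e) = finLpNorm p a :=
  (LinearIsometryEquiv.piLpCongrLeft p ℝ ℝ e.symm).norm_map (WithLp.toLp p a)

/-- The source of constant 1 in both parts: families can be concatenated without loss in the
`ℓ_p`-norm. -/
theorem sigma {κ : ι → Type*} [∀ i, Fintype (κ i)] (a : (Σ i, κ i) → ℝ) :
    finLpNorm p a = finLpNorm p (fun i => finLpNorm p (fun k => a ⟨i, k⟩)) := by
  have h := (LinearIsometryEquiv.piLpCurry ℝ p (fun (i : ι) (_ : κ i) => ℝ)).norm_map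
    (WithLp.toLp p a)
  rw [LinearIsometryEquiv.piLpCurry_apply] at h
  rw [finLpNorm, ← h]
  rcases eq_or_ne p ⊤ with rfl | hp'
  · simp only [finLpNorm, PiLp.norm_eq_ciSup]
    simp only [Sigma.curry, Real.norm_eq_abs]
    refine iSup_congr fun i => ?_
    rw [abs_of_nonneg (Real.iSup_nonneg fun _ => abs_nonneg _)]
  · have h0 : 0 < p.toReal := ENNReal.toReal_pos (zero_lt_one.trans_le hp.out).ne' hp'
    simp only [finLpNorm, PiLp.norm_eq_sum h0]
    congr 1
    refine Finset.sum_congr rfl fun i _ => ?_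
    rw [Real.norm_of_nonneg (by positivity)]
    rfl

theorem mono {a b : ι → ℝ} (h : ∀ i, |a i| ≤ |b i|) : finLpNorm p a ≤ finLpNorm p b := by
  rcases eq_or_ne p ⊤ with rfl | hp'
  · simp only [finLpNorm, PiLp.norm_eq_ciSup]
    exact ciSup_mono (Set.finite_range _).bddAbove h
  · have h0 : 0 < p.toReal := ENNReal.toReal_pos (zero_lt_one.trans_le hp.out).ne' hp'
    simp only [finLpNorm, PiLp.norm_eq_sum h0]
    gcongr with i
    exact h i

theorem add_le (a b : ι → ℝ) :
    finLpNorm p (fun i => a i + b i) ≤ finLpNorm p a + finLpNorm p b :=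
  norm_add_le (WithLp.toLp p a : PiLp p (fun _ : ι => ℝ)) (WithLp.toLp p b)

theorem const_mul (c : ℝ) (a : ι → ℝ) :
    finLpNorm p (fun i => c * a i) = |c| * finLpNorm p a :=
  norm_smul c (WithLp.toLp p a : PiLp p (fun _ : ι => ℝ))

theorem abs_apply_le (a : ι → ℝ) (i : ι) : |a i| ≤ finLpNorm p a :=
  PiLp.norm_apply_le (WithLp.toLp p a : PiLp p (fun _ : ι => ℝ)) i

theorem of_isEmpty [IsEmpty ι] (a : ι → ℝ) : finLpNorm p a = 0 := by
  have : (WithLp.toLp p a : PiLp p (fun _ : ι => ℝ)) = 0 := by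
    ext i
    exact isEmptyElim i
  rw [finLpNorm, this, norm_zero]

theorem of_unique [Unique ι] (a : ι → ℝ) : finLpNorm p a = |a default| := by
  rcases eq_or_ne p ⊤ with rfl | hp'
  · simp [finLpNorm, PiLp.norm_eq_ciSup]
  · have h0 : 0 < p.toReal := ENNReal.toReal_pos (zero_lt_one.trans_le hp.out).ne' hp'
    rw [finLpNorm, PiLp.norm_eq_sum h0, Fintype.sum_unique,
      ← Real.rpow_mul (norm_nonneg _), mul_one_div_cancel h0.ne', Real.rpow_one]
    rfl

theorem continuous {α : Type*} [TopologicalSpace α] {f : α → ι → ℝ}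
    (hf : ∀ i, Continuous fun t => f t i) : Continuous fun t => finLpNorm p (f t) :=
  ((PiLp.continuous_toLp p _).comp (continuous_pi hf)).norm

end finLpNorm

/-! ### Convexity and concavity inequalities over arbitrary finite index types -/

section Convexity

variable {p : ℝ≥0∞} [hp : Fact (1 ≤ p)] {E X : Type*} [NormedAddCommGroup E] [NormedSpace ℝ E]
  [NormedAddCommGroup X] [Lattice X] [NormedSpace ℝ X] {K : ℝ}

theorem IsPInftyConvexWith.norm_sup'_le {T : E →L[ℝ] X} (h : IsPInftyConvexWith p K T)
    {ι : Type*} [Fintype ι] [Nonempty ι] (x : ι → E) :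
    ‖Finset.univ.sup' Finset.univ_nonempty (fun i => |T (x i)|)‖ ≤
      K * finLpNorm p (fun i => ‖x i‖) := by
  obtain ⟨n, hn⟩ := Nat.exists_eq_succ_of_ne_zero (Fintype.card_ne_zero (α := ι))
  let e : Fin (n + 1) ≃ ι := (Fintype.equivFinOfCardEq hn).symm
  have := h n (x ∘ e)
  rw [ellNorm_eq_finLpNorm] at this
  refine le_of_eq_of_le (congrArg _ ?_)
    (this.trans_eq (congrArg _ (finLpNorm.comp_equiv e fun i => ‖x i‖)))
  apply le_antisymm
  · refine Finset.sup'_le _ _ fun i _ => ?_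
    refine le_trans (le_of_eq ?_) (Finset.le_sup' _ (Finset.mem_univ (e.symm i)))
    simp
  · exact Finset.sup'_le _ _ fun i _ =>
      Finset.le_sup' (fun i => |T (x i)|) (Finset.mem_univ (e i))

theorem IsPOneConcaveWith.finLpNorm_le {T : X →L[ℝ] E} (h : IsPOneConcaveWith p K T)
    {ι : Type*} [Fintype ι] (x : ι → X) :
    finLpNorm p (fun i => ‖T (x i)‖) ≤ K * ‖∑ i, |x i|‖ := by
  rcases isEmpty_or_nonempty ι with hι | hι
  · simp [finLpNorm.of_isEmpty]
  obtain ⟨n, hn⟩ := Nat.exists_eq_succ_of_ne_zero (Fintype.card_ne_zero (α := ι))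
  let e : Fin (n + 1) ≃ ι := (Fintype.equivFinOfCardEq hn).symm
  have := h n (x ∘ e)
  rw [ellNorm_eq_finLpNorm] at this
  refine le_of_eq_of_le (finLpNorm.comp_equiv e fun i => ‖T (x i)‖).symm (this.trans_eq ?_)
  rw [← e.sum_comp]
  rfl

end Convexity

section VectorLattice

variable {X : Type*} [AddCommGroup X] [Lattice X]

theorem eq_zero_of_abs_nonpos [IsOrderedAddMonoid X] {x : X} (h : |x| ≤ 0) : x = 0 :=
  le_antisymm ((le_abs_self x).trans h) (neg_nonpos.1 ((neg_le_abs x).trans h))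

variable [Module ℝ X] [IsOrderedModule ℝ X]

theorem smul_sup_of_nonneg {c : ℝ} (hc : 0 ≤ c) (x y : X) : c • (x ⊔ y) = c • x ⊔ c • y := by
  rcases hc.eq_or_lt with rfl | hc
  · simp
  · exact (OrderIso.smulRight hc).map_sup x y

theorem abs_real_smul [IsOrderedAddMonoid X] (c : ℝ) (x : X) : |c • x| = |c| • |x| := by
  rcases le_total 0 c with hc | hc
  · rw [abs_of_nonneg hc, abs, abs, smul_sup_of_nonneg hc, smul_neg]
  · rw [abs_of_nonpos hc, abs, abs, smul_sup_of_nonneg (neg_nonneg.2 hc), smul_neg, neg_smul,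
      neg_neg, sup_comm]

end VectorLattice

/-! ### Order ideals normed by the gauge of a disc -/

/-- A closed, bounded, convex, solid set containing the origin: the closed unit balls of the
Banach lattices that are continuously included in `X` as order ideals. -/
structure IsLatticeDisc {X : Type*} [NormedAddCommGroup X] [Lattice X] [NormedSpace ℝ X]
    (B : Set X) : Prop where
  zero_mem : (0 : X) ∈ B
  convex : Convex ℝ B
  solid : LatticeOrderedAddCommGroup.IsSolid B
  isClosed : IsClosed B
  exists_bound : ∃ C : ℝ, ∀ x ∈ B, ‖x‖ ≤ C

namespace IsLatticeDisc

variable {X : Type*} [NormedAddCommGroup X] [Lattice X] [NormedSpace ℝ X] {B : Set X}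

theorem smul_mono (hB : IsLatticeDisc B) {r s : ℝ} (hr : 0 ≤ r) (hrs : r ≤ s) :
    r • B ⊆ s • B := by
  intro x hx
  rw [show s = r + (s - r) by ring, hB.convex.add_smul hr (by linarith)]
  exact ⟨x, hx, 0, ⟨0, hB.zero_mem, smul_zero _⟩, add_zero x⟩

theorem add_mem_smul (hB : IsLatticeDisc B) {r s : ℝ} (hr : 0 ≤ r) (hs : 0 ≤ s) {x y : X}
    (hx : x ∈ r • B) (hy : y ∈ s • B) : x + y ∈ (r + s) • B := by
  rw [hB.convex.add_smul hr hs]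
  exact Set.add_mem_add hx hy

theorem exists_bound_smul (hB : IsLatticeDisc B) :
    ∃ C : ℝ, 0 ≤ C ∧ ∀ r : ℝ, 0 ≤ r → ∀ x ∈ r • B, ‖x‖ ≤ C * r := by
  obtain ⟨C, hC⟩ := hB.exists_bound
  refine ⟨C, by simpa using hC 0 hB.zero_mem, ?_⟩
  rintro r hr _ ⟨b, hb, rfl⟩
  change ‖r • b‖ ≤ _
  rw [norm_smul, Real.norm_of_nonneg hr, mul_comm]
  exact mul_le_mul_of_nonneg_right (hC b hb) hr

/-- Closedness of `B` makes the infimum in the gauge attained when `r > 0`; boundedness settles `r =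
0`, where `0 • B = {0}`. -/
theorem gauge_le_iff (hB : IsLatticeDisc B) {x : X} (hx : ∃ r : ℝ, 0 < r ∧ x ∈ r • B) {r : ℝ}
    (hr : 0 ≤ r) : gauge B x ≤ r ↔ x ∈ r • B := by
  refine ⟨fun h => ?_, gauge_le_of_mem hr⟩
  have key : ∀ s, r < s → x ∈ s • B := by
    intro s hs
    obtain ⟨t, ⟨ht0, ht⟩, hts⟩ := exists_lt_of_csInf_lt
      (s := {r | r ∈ Set.Ioi (0 : ℝ) ∧ x ∈ r • B}) hx (lt_of_le_of_lt h hs)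
    exact hB.smul_mono (le_of_lt ht0) hts.le ht
  rcases hr.eq_or_lt with rfl | hr
  · obtain ⟨C, hC0, hC⟩ := hB.exists_bound_smul
    have hx0 : x = 0 := by
      rw [← norm_le_zero_iff]
      refine le_of_forall_pos_le_add fun ε hε => ?_
      have h1 := hC (ε / (C + 1)) (by positivity) x (key _ (by positivity))
      refine h1.trans ?_
      rw [zero_add, mul_div_assoc', div_le_iff₀ (by positivity)]
      nlinarith
    exact ⟨0, hB.zero_mem, by simp [hx0]⟩
  · rw [Set.mem_smul_set_iff_inv_smul_mem₀ hr.ne']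
    -- Let `s` decrease to `r` in `s⁻¹ • x ∈ B`.
    have hmem : ∀ᶠ s in nhdsWithin r (Set.Ioi r), s⁻¹ • x ∈ B := by
      filter_upwards [self_mem_nhdsWithin] with s hs
      rw [← Set.mem_smul_set_iff_inv_smul_mem₀ (hr.trans hs).ne']
      exact key s hs
    refine hB.isClosed.mem_of_tendsto ?_ hmem
    exact ((Filter.tendsto_id.mono_left nhdsWithin_le_nhds).inv₀ hr.ne').smul_const x

variable [IsBanachLattice X]

theorem mem_smul_of_abs_le (hB : IsLatticeDisc B) {r : ℝ} (hr : 0 ≤ r) {x y : X}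
    (hy : y ∈ r • B) (h : |x| ≤ |y|) : x ∈ r • B := by
  rcases hr.eq_or_lt with rfl | hr
  · obtain ⟨b, -, rfl⟩ := hy
    have h : |x| ≤ |(0 : ℝ) • b| := h
    rw [zero_smul, abs_zero] at h
    have hx : x = 0 := eq_zero_of_abs_nonpos h
    exact ⟨0, hB.zero_mem, by simp [hx]⟩
  · rw [Set.mem_smul_set_iff_inv_smul_mem₀ hr.ne'] at hy ⊢
    refine hB.solid hy ?_
    rw [abs_real_smul, abs_real_smul]
    exact smul_le_smul_of_nonneg_left h (abs_nonneg _)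

/-- The order ideal spanned by a lattice disc. -/
def submodule (hB : IsLatticeDisc B) : Submodule ℝ X where
  carrier := {x | ∃ r : ℝ, 0 < r ∧ x ∈ r • B}
  zero_mem' := ⟨1, one_pos, 0, hB.zero_mem, smul_zero _⟩
  add_mem' := by
    rintro x y ⟨r, hr, hx⟩ ⟨s, hs, hy⟩
    exact ⟨r + s, add_pos hr hs, hB.add_mem_smul hr.le hs.le hx hy⟩
  smul_mem' := by
    rintro c x ⟨r, hr, b, hb, rfl⟩
    -- The `+ 1` keeps the dilation factor positive when `c = 0`.
    refine ⟨(|c| + 1) * r, by positivity, ?_⟩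
    refine hB.smul_mono (r := |c| * r) (by positivity) (by gcongr; linarith) ?_
    refine hB.mem_smul_of_abs_le (by positivity) ⟨b, hb, rfl⟩ ?_
    simp [abs_real_smul, smul_smul, abs_mul]

theorem mem_submodule_of_abs_le (hB : IsLatticeDisc B) {x y : X} (hy : y ∈ hB.submodule)
    (h : |x| ≤ |y|) : x ∈ hB.submodule := by
  obtain ⟨r, hr, hy⟩ := hy
  exact ⟨r, hr, hB.mem_smul_of_abs_le hr.le hy h⟩

theorem abs_mem_submodule (hB : IsLatticeDisc B) {x : X} (hx : x ∈ hB.submodule) :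
    |x| ∈ hB.submodule := hB.mem_submodule_of_abs_le hx (abs_abs x).le

theorem sup_mem_submodule (hB : IsLatticeDisc B) {x y : X} (hx : x ∈ hB.submodule)
    (hy : y ∈ hB.submodule) : x ⊔ y ∈ hB.submodule := by
  refine hB.mem_submodule_of_abs_le
    (add_mem (hB.abs_mem_submodule hx) (hB.abs_mem_submodule hy)) ?_
  rw [abs_of_nonneg (add_nonneg (abs_nonneg x) (abs_nonneg y))]
  have h1 : |x| ≤ |x| + |y| := le_add_of_nonneg_right (abs_nonneg y)
  have h2 : |y| ≤ |x| + |y| := le_add_of_nonneg_left (abs_nonneg x)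
  refine abs_le'.2 ⟨sup_le ((le_abs_self x).trans h1) ((le_abs_self y).trans h2), ?_⟩
  rw [neg_sup]
  exact inf_le_left.trans ((neg_le_abs x).trans h1)

theorem inf_mem_submodule (hB : IsLatticeDisc B) {x y : X} (hx : x ∈ hB.submodule)
    (hy : y ∈ hB.submodule) : x ⊓ y ∈ hB.submodule := by
  have := neg_mem (hB.sup_mem_submodule (neg_mem hx) (neg_mem hy))
  rwa [neg_sup, neg_neg, neg_neg] at this

/-- The order ideal spanned by a lattice disc, normed by the gauge of the disc. -/
def Space (hB : IsLatticeDisc B) : Type _ := hB.submodule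

namespace Space

variable (hB : IsLatticeDisc B)

noncomputable instance : AddCommGroup hB.Space := inferInstanceAs (AddCommGroup hB.submodule)

noncomputable instance : Module ℝ hB.Space := inferInstanceAs (Module ℝ hB.submodule)

noncomputable instance : Lattice hB.Space :=
  Subtype.lattice (fun _ _ hx hy => hB.sup_mem_submodule hx hy)
    fun _ _ hx hy => hB.inf_mem_submodule hx hy

/-- The inclusion into the ambient lattice, as a linear map. -/
def incl : hB.Space →ₗ[ℝ] X := hB.submodule.subtype

theorem incl_injective : Function.Injective (incl hB) := Subtype.val_injective

theorem incl_sup (x y : hB.Space) : incl hB (x ⊔ y) = incl hB x ⊔ incl hB y := rfl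

theorem incl_le_incl {x y : hB.Space} : incl hB x ≤ incl hB y ↔ x ≤ y := Iff.rfl

theorem incl_abs (x : hB.Space) : incl hB |x| = |incl hB x| := by
  rw [abs, incl_sup, map_neg]
  rfl

theorem incl_mem (x : hB.Space) : ∃ r : ℝ, 0 < r ∧ incl hB x ∈ r • B := x.2

theorem exists_incl_eq {x : X} {r : ℝ} (hr : 0 ≤ r) (hx : x ∈ r • B) :
    ∃ y : hB.Space, incl hB y = x :=
  ⟨⟨x, r + 1, by linarith, hB.smul_mono hr (by linarith) hx⟩, rfl⟩

theorem incl_mem_gauge_smul (x : hB.Space) : incl hB x ∈ gauge B (incl hB x) • B :=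
  (hB.gauge_le_iff (incl_mem hB x) (gauge_nonneg _)).1 le_rfl

noncomputable instance : NormedAddCommGroup hB.Space :=
  AddGroupNorm.toNormedAddCommGroup
    { toFun := fun x => gauge B (incl hB x)
      map_zero' := by rw [map_zero, gauge_zero]
      add_le' := fun x y => by
        rw [hB.gauge_le_iff (incl_mem hB _) (add_nonneg (gauge_nonneg _) (gauge_nonneg _)), map_add]
        exact hB.add_mem_smul (gauge_nonneg _) (gauge_nonneg _) (incl_mem_gauge_smul hB x)
          (incl_mem_gauge_smul hB y)
      neg' := fun x => by
        rw [map_neg]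
        refine gauge_neg (fun b hb => hB.solid hb (abs_neg b).le) _
      eq_zero_of_map_eq_zero' := fun x hx => by
        have := incl_mem_gauge_smul hB x
        have hx : gauge B (incl hB x) = 0 := hx
        rw [hx] at this
        obtain ⟨b, -, h⟩ := this
        apply incl_injective hB
        rw [← h, map_zero]
        exact zero_smul ℝ b }

theorem norm_le_iff (x : hB.Space) {r : ℝ} (hr : 0 ≤ r) : ‖x‖ ≤ r ↔ incl hB x ∈ r • B :=
  hB.gauge_le_iff (incl_mem hB x) hr

theorem incl_mem_norm_smul (x : hB.Space) : incl hB x ∈ ‖x‖ • B := incl_mem_gauge_smul hB x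

noncomputable instance : NormedSpace ℝ hB.Space where
  norm_smul_le c x := by
    rw [norm_le_iff hB _ (by positivity), map_smul]
    obtain ⟨b, hb, h⟩ := incl_mem_norm_smul hB x
    have h : ‖x‖ • b = incl hB x := h
    refine hB.mem_smul_of_abs_le (by positivity) ⟨b, hb, rfl⟩ ?_
    rw [← h]
    simp [abs_real_smul, smul_smul, abs_mul]

/-- The inclusion into the ambient lattice, as a bounded operator. -/
noncomputable def inclL : hB.Space →L[ℝ] X :=
  (incl hB).mkContinuousOfExistsBound (by
    obtain ⟨C, -, hC⟩ := hB.exists_bound_smul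
    exact ⟨C, fun x => hC _ (norm_nonneg x) _ (incl_mem_norm_smul hB x)⟩)

theorem inclL_apply (x : hB.Space) : inclL hB x = incl hB x := rfl

instance : CompleteSpace hB.Space := by
  refine Metric.complete_of_cauchySeq_tendsto fun f hf => ?_
  obtain ⟨x, hx⟩ := cauchySeq_tendsto_of_complete
    ((inclL hB).uniformContinuous.comp_cauchySeq hf)
  -- The limit `x` exists in `X`; since `ε • B` is closed, the gauge Cauchy estimate passes to it.
  have key : ∀ ε : ℝ, 0 < ε → ∃ N, ∀ n ≥ N, incl hB (f n) - x ∈ ε • B := by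
    intro ε hε
    obtain ⟨N, hN⟩ := Metric.cauchySeq_iff.1 hf ε hε
    refine ⟨N, fun n hn => ?_⟩
    have hcl : IsClosed (ε • B) := hB.isClosed.smul_of_ne_zero hε.ne'
    refine hcl.mem_of_tendsto (tendsto_const_nhds.sub hx) ?_
    filter_upwards [Filter.eventually_ge_atTop N] with m hm
    have h1 : ‖f n - f m‖ ≤ ε := by
      rw [← dist_eq_norm]
      exact (hN n hn m hm).le
    rw [norm_le_iff hB _ hε.le, map_sub] at h1
    exact h1
  obtain ⟨N, hN⟩ := key 1 one_pos
  obtain ⟨z, hz⟩ := exists_incl_eq hB zero_le_one (hN N le_rfl)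
  have hz' : incl hB (f N - z) = x := by rw [map_sub, hz]; abel
  -- `z` represents `f N - x`, so `f N - z` represents `x`, which is thereby in the ideal.
  refine ⟨f N - z, ?_⟩
  rw [Metric.tendsto_atTop]
  intro ε hε
  obtain ⟨M, hM⟩ := key (ε / 2) (by positivity)
  refine ⟨M, fun n hn => ?_⟩
  rw [dist_eq_norm]
  refine lt_of_le_of_lt ((norm_le_iff hB _ (by positivity)).2 ?_) (half_lt_self hε)
  rw [map_sub, hz']
  exact hM n hn

instance : IsBanachLattice hB.Space where
  solid x y h := by
    rw [norm_le_iff hB _ (norm_nonneg _)]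
    refine hB.mem_smul_of_abs_le (norm_nonneg _) (incl_mem_norm_smul hB y) ?_
    rwa [← incl_abs, ← incl_abs, incl_le_incl]
  add_le_add_left x y h z := by
    rw [← incl_le_incl hB, map_add, map_add]
    exact add_le_add_left ((incl_le_incl hB).2 h) _
  smul_le_smul_of_nonneg_left r hr x y h := by
    rw [← incl_le_incl hB, map_smul, map_smul]
    exact smul_le_smul_of_nonneg_left ((incl_le_incl hB).2 h) hr
  smul_le_smul_of_nonneg_right x hx r s h := by
    rw [← incl_le_incl hB, map_smul, map_smul]
    exact smul_le_smul_of_nonneg_right h ((incl_le_incl hB).2 hx)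

theorem inclL_image_closedBall : inclL hB '' Metric.closedBall 0 1 = B := by
  ext x
  constructor
  · rintro ⟨y, hy, rfl⟩
    rw [mem_closedBall_zero_iff, norm_le_iff hB _ zero_le_one, one_smul] at hy
    exact hy
  · intro hx
    have hx' : x ∈ (1 : ℝ) • B := by rwa [one_smul]
    obtain ⟨y, rfl⟩ := exists_incl_eq hB zero_le_one hx'
    exact ⟨y, mem_closedBall_zero_iff.2 ((norm_le_iff hB _ zero_le_one).2 hx'), rfl⟩

theorem isClassC_inclL : IsClassC (inclL hB) where
  injective := incl_injective hB
  intervalPreserving := by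
    refine ⟨fun x hx => hx, fun x hx => ?_⟩
    ext y
    constructor
    · rintro ⟨z, ⟨hz0, hz⟩, rfl⟩
      exact ⟨hz0, hz⟩
    · rintro ⟨hy0, hy⟩
      have : |y| ≤ |incl hB x| := by
        rw [abs_of_nonneg hy0]
        exact hy.trans (le_abs_self _)
      exact ⟨⟨y, hB.mem_submodule_of_abs_le x.2 this⟩, ⟨hy0, hy⟩, rfl⟩
  latticeHomomorphism := fun _ _ => ⟨rfl, rfl⟩
  isClosed_image_ball := by
    rw [inclL_image_closedBall]
    exact hB.isClosed

end Space

end IsLatticeDisc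

/-! ### Factorization of `(p,∞)`-convex operators -/

section ConvexFactorization

variable {p : ℝ≥0∞} {E X : Type*} [NormedAddCommGroup E] [NormedSpace ℝ E]
  [NormedAddCommGroup X] [Lattice X] [NormedSpace ℝ X]

/-- The suprema `⋁ i, |T (x i)|` over finite families with `(∑ i, ‖x i‖ ^ p) ^ (1 / p) ≤ 1`. -/
def pConvexGenerators (p : ℝ≥0∞) (T : E →L[ℝ] X) : Set X :=
  {u | ∃ (ι : Type) (_ : Fintype ι) (_ : Nonempty ι) (x : ι → E),
    finLpNorm p (fun i => ‖x i‖) ≤ 1 ∧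
      u = Finset.univ.sup' Finset.univ_nonempty (fun i => |T (x i)|)}

/-- The smallest closed, convex, solid set containing `pConvexGenerators p T`. -/
def pConvexDisc (p : ℝ≥0∞) (T : E →L[ℝ] X) : Set X :=
  closure {y | ∃ w ∈ convexHull ℝ (pConvexGenerators p T), |y| ≤ w}

theorem IsLatticeHomomorphism.map_abs {Y : Type*} [NormedAddCommGroup Y] [Lattice Y]
    [NormedSpace ℝ Y] {V : X →L[ℝ] Y} (hV : IsLatticeHomomorphism V) (x : X) : V |x| = |V x| := by
  rw [abs, (hV x (-x)).1, map_neg]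
  rfl

theorem IsLatticeHomomorphism.map_sup' {Y : Type*} [NormedAddCommGroup Y] [Lattice Y]
    [NormedSpace ℝ Y] {V : X →L[ℝ] Y} (hV : IsLatticeHomomorphism V) {ι : Type*} [Fintype ι]
    [Nonempty ι] (f : ι → X) : V (Finset.univ.sup' Finset.univ_nonempty f) =
      Finset.univ.sup' Finset.univ_nonempty (fun i => V (f i)) :=
  Finset.apply_sup'_eq_sup'_comp Finset.univ_nonempty V fun x y => (hV x y).1

section ClassC

variable {Y : Type*} [NormedAddCommGroup Y] [Lattice Y] [NormedSpace ℝ Y] {V : Y →L[ℝ] X}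

theorem IsClassC.le_of_map_le (hV : IsClassC V) {a b : Y} (h : V a ≤ V b) : a ≤ b := by
  rw [← sup_eq_right]
  apply hV.injective
  rw [(hV.latticeHomomorphism a b).1, sup_eq_right.2 h]

theorem IsClassC.isClosed_image_closedBall (hV : IsClassC V) {c : ℝ} (hc : 0 < c) :
    IsClosed (V '' Metric.closedBall 0 c) := by
  rw [← smul_unitClosedBall_of_nonneg hc.le, Set.image_smul_comm _ _ _ (map_smul V c)]
  exact hV.isClosed_image_ball.smul_of_ne_zero hc.ne'

/-- The lift is `V⁻¹ ∘ W`, bounded by `c` thanks to the inclusion of balls. As `V` is injective and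
reflects order, each Class `𝒞` property of `φ` can be checked after applying `V`. -/
theorem IsClassC.exists_lift (hV : IsClassC V) {Z : Type*} [NormedAddCommGroup Z] [Lattice Z]
    [NormedSpace ℝ Z] {W : Z →L[ℝ] X} (hW : IsClassC W) {c : ℝ}
    (hsub : W '' Metric.closedBall 0 1 ⊆ V '' Metric.closedBall 0 c) :
    ∃ φ : Z →L[ℝ] Y, IsClassC φ ∧ W = V.comp φ := by
  have key : ∀ z : Z, ∃ y : Y, V y = W z ∧ ‖y‖ ≤ c * ‖z‖ := by
    intro z
    rcases eq_or_ne z 0 with rfl | hz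
    · exact ⟨0, by simp, by simp⟩
    · have hz' := norm_ne_zero_iff.2 hz
      obtain ⟨y, hy, hyz⟩ := hsub ⟨‖z‖⁻¹ • z, by
        rw [mem_closedBall_zero_iff, norm_smul, norm_inv, norm_norm, inv_mul_cancel₀ hz'], rfl⟩
      refine ⟨‖z‖ • y, by rw [map_smul, hyz, map_smul, smul_inv_smul₀ hz'], ?_⟩
      rw [norm_smul, norm_norm, mul_comm]
      exact mul_le_mul_of_nonneg_right (mem_closedBall_zero_iff.1 hy) (norm_nonneg z)
  choose f hf hfn using key
  let φ : Z →L[ℝ] Y := LinearMap.mkContinuous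
    { toFun := f
      map_add' := fun x y => hV.injective (by simp only [map_add, hf])
      map_smul' := fun r x => hV.injective (by simp only [map_smul, hf, RingHom.id_apply]) } c hfn
  have hφ : ∀ z, V (φ z) = W z := hf
  refine ⟨φ, ⟨?_, ⟨?_, ?_⟩, ?_, ?_⟩, ContinuousLinearMap.ext fun z => (hφ z).symm⟩
  · intro x y hxy
    apply hW.injective
    rw [← hφ, ← hφ, hxy]
  · intro x hx
    apply hV.le_of_map_le
    rw [hφ, map_zero]
    exact hW.intervalPreserving.1 x hx
  · intro x hx
    ext y
    constructor
    · rintro ⟨z, hz, rfl⟩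
      have h := hW.intervalPreserving.2 x hx ▸ Set.mem_image_of_mem W hz
      refine ⟨hV.le_of_map_le ?_, hV.le_of_map_le ?_⟩
      · rw [hφ, map_zero]
        exact h.1
      · rw [hφ, hφ]
        exact h.2
    · intro hy
      have hx' : 0 ≤ φ x := hy.1.trans hy.2
      have h := hV.intervalPreserving.2 _ hx' ▸ Set.mem_image_of_mem V hy
      rw [hφ, ← hW.intervalPreserving.2 x hx] at h
      obtain ⟨z, hz, hzy⟩ := h
      exact ⟨z, hz, hV.injective (by rw [hφ, hzy])⟩
  · intro x y
    constructor <;> apply hV.injective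
    · rw [hφ, (hV.latticeHomomorphism _ _).1, hφ, hφ, (hW.latticeHomomorphism _ _).1]
    · rw [hφ, (hV.latticeHomomorphism _ _).2, hφ, hφ, (hW.latticeHomomorphism _ _).2]
  · have : φ '' Metric.closedBall 0 1 = V ⁻¹' (W '' Metric.closedBall 0 1) := by
      ext y
      constructor
      · rintro ⟨z, hz, rfl⟩
        exact ⟨z, hz, (hφ z).symm⟩
      · rintro ⟨z, hz, hzy⟩
        exact ⟨z, hz, hV.injective (by rw [hφ, hzy])⟩
    rw [this]
    exact hW.isClosed_image_ball.preimage V.continuous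

end ClassC

namespace pConvexDisc

theorem subset_of_generators_subset {T : E →L[ℝ] X} {A : Set X}
    (hT : pConvexGenerators p T ⊆ A) (hconv : Convex ℝ A)
    (hsolid : LatticeOrderedAddCommGroup.IsSolid A) (hcl : IsClosed A) :
    pConvexDisc p T ⊆ A := by
  refine closure_minimal ?_ hcl
  rintro y ⟨w, hw, hyw⟩
  exact hsolid (convexHull_min hT hconv hw) (hyw.trans (le_abs_self w))

theorem apply_mem [Fact (1 ≤ p)] (T : E →L[ℝ] X) {x : E} (hx : ‖x‖ ≤ 1) : T x ∈ pConvexDisc p T := by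
  refine subset_closure ⟨|T x|, subset_convexHull ℝ _ ?_, le_rfl⟩
  refine ⟨Unit, inferInstance, inferInstance, fun _ => x, ?_, ?_⟩
  · rwa [finLpNorm.of_unique, abs_of_nonneg (norm_nonneg x)]
  · simp

end pConvexDisc

variable [IsBanachLattice X]

theorem smul_sup'_of_nonneg {ι : Type*} [Fintype ι] [Nonempty ι] {c : ℝ} (hc : 0 ≤ c)
    (f : ι → X) : c • Finset.univ.sup' Finset.univ_nonempty f =
      Finset.univ.sup' Finset.univ_nonempty (fun i => c • f i) :=
  Finset.apply_sup'_eq_sup'_comp Finset.univ_nonempty (fun x => c • x) (smul_sup_of_nonneg hc)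

theorem convex_setOf_exists_mem_abs_le {C : Set X} (hC : Convex ℝ C) :
    Convex ℝ {y : X | ∃ w ∈ C, |y| ≤ w} := by
  rintro y ⟨w, hw, hyw⟩ z ⟨w', hw', hzw⟩ a b ha hb hab
  refine ⟨a • w + b • w', hC hw hw' ha hb hab, (abs_add_le _ _).trans ?_⟩
  rw [abs_real_smul, abs_real_smul, abs_of_nonneg ha, abs_of_nonneg hb]
  exact add_le_add (smul_le_smul_of_nonneg_left hyw ha) (smul_le_smul_of_nonneg_left hzw hb)

/-- Truncating `y` to `[-|z|, |z|]` is continuous in `z`, lands in `S` for `z ∈ S`, and returns `y`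
at `z = x`. -/
theorem isSolid_closure {S : Set X} (hS : LatticeOrderedAddCommGroup.IsSolid S) :
    LatticeOrderedAddCommGroup.IsSolid (closure S) := by
  intro x hx y hyx
  have hf : Continuous fun z : X => (y ⊓ |z|) ⊔ -|z| := by
    have : Continuous fun z : X => |z| := continuous_id.sup continuous_neg
    exact (continuous_const.inf this).sup this.neg
  have h := map_mem_closure hf hx (t := S) fun z hz => hS hz ?_
  · have h1 : y ⊓ |x| = y := inf_eq_left.2 ((le_abs_self y).trans hyx)
    have h2 : y ⊔ -|x| = y := sup_eq_left.2 (neg_le.1 ((neg_le_abs y).trans hyx))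
    rwa [h1, h2] at h
  · refine abs_le'.2 ⟨sup_le inf_le_right (neg_le_self (abs_nonneg z)), ?_⟩
    exact neg_le.1 le_sup_right

namespace pConvexDisc

variable [hp : Fact (1 ≤ p)]

/-- The dominating generator comes from the concatenation of the families of the `u i`, the `i`-th
one scaled by `a i`. -/
theorem exists_generator_ge {T : E →L[ℝ] X} {ι : Type} [Fintype ι] [Nonempty ι] {a : ι → ℝ}
    (ha : finLpNorm p a ≤ 1) {u : ι → X} (hu : ∀ i, u i ∈ pConvexGenerators p T) :
    ∃ w ∈ pConvexGenerators p T,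
      Finset.univ.sup' Finset.univ_nonempty (fun i => |a i| • u i) ≤ w := by
  choose κ hκ hκ' x hx hux using hu
  have : Nonempty (Σ i, κ i) := ⟨⟨Classical.arbitrary ι, Classical.arbitrary _⟩⟩
  refine ⟨_, ⟨Σ i, κ i, inferInstance, this, fun s => a s.1 • x s.1 s.2, ?_, rfl⟩, ?_⟩
  · rw [finLpNorm.sigma]
    refine le_trans (finLpNorm.mono fun i => ?_) ha
    simp only [norm_smul, Real.norm_eq_abs, finLpNorm.const_mul, abs_abs]
    rw [abs_of_nonneg (mul_nonneg (abs_nonneg _) (finLpNorm.nonneg _))]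
    exact mul_le_of_le_one_right (abs_nonneg _) (hx i)
  · refine Finset.sup'_le _ _ fun i _ => ?_
    rw [hux, smul_sup'_of_nonneg (abs_nonneg _)]
    refine Finset.sup'_le _ _ fun k _ => ?_
    refine le_trans (le_of_eq ?_) (Finset.le_sup' _ (Finset.mem_univ (⟨i, k⟩ : Σ i, κ i)))
    simp [abs_real_smul]

/-- For fixed `a`, the tuples `u` admitting a dominating `w` form a convex set, since a supremum of
sums is at most the sum of suprema. It contains the product of the generator sets, hence its convex
hull, which is the product of the hulls. -/
theorem exists_convexHull_ge {T : E →L[ℝ] X} {ι : Type} [Fintype ι] [Nonempty ι] {a : ι → ℝ}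
    (ha : finLpNorm p a ≤ 1) {u : ι → X}
    (hu : ∀ i, u i ∈ convexHull ℝ (pConvexGenerators p T)) :
    ∃ w ∈ convexHull ℝ (pConvexGenerators p T),
      Finset.univ.sup' Finset.univ_nonempty (fun i => |a i| • u i) ≤ w := by
  let A : Set (ι → X) := {u | ∃ w ∈ convexHull ℝ (pConvexGenerators p T),
    Finset.univ.sup' Finset.univ_nonempty (fun i => |a i| • u i) ≤ w}
  have hA : Convex ℝ A := by
    rintro u ⟨w, hw, huw⟩ u' ⟨w', hw', huw'⟩ r s hr hs hrs
    refine ⟨r • w + s • w', convex_convexHull ℝ _ hw hw' hr hs hrs, ?_⟩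
    refine Finset.sup'_le _ _ fun i hi => ?_
    rw [Pi.add_apply, Pi.smul_apply, Pi.smul_apply, smul_add, smul_comm _ r, smul_comm _ s]
    exact add_le_add
      (smul_le_smul_of_nonneg_left ((Finset.le_sup' (fun i => |a i| • u i) hi).trans huw) hr)
      (smul_le_smul_of_nonneg_left ((Finset.le_sup' (fun i => |a i| • u' i) hi).trans huw') hs)
  have hsub : Set.univ.pi (fun _ : ι => pConvexGenerators p T) ⊆ A := by
    intro u hu
    obtain ⟨w, hw, huw⟩ := exists_generator_ge ha fun i => hu i (Set.mem_univ i)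
    exact ⟨w, subset_convexHull ℝ _ hw, huw⟩
  have h := convexHull_min hsub hA
  rw [convexHull_pi] at h
  exact h fun i _ => hu i

theorem sup'_mem {T : E →L[ℝ] X} {ι : Type} [Fintype ι] [Nonempty ι] {a : ι → ℝ}
    (ha : finLpNorm p a ≤ 1) {y : ι → X} (hy : ∀ i, y i ∈ pConvexDisc p T) :
    Finset.univ.sup' Finset.univ_nonempty (fun i => |a i| • |y i|) ∈ pConvexDisc p T := by
  have hf : Continuous fun z : ι → X =>
      Finset.univ.sup' Finset.univ_nonempty (fun i => |a i| • |z i|) := by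
    refine Continuous.finset_sup'_apply _ fun i _ => ?_
    have : Continuous fun z : X => |z| := continuous_id.sup continuous_neg
    exact (this.comp (continuous_apply i)).const_smul _
  have hy' : y ∈ closure (Set.univ.pi fun _ : ι =>
      {y | ∃ w ∈ convexHull ℝ (pConvexGenerators p T), |y| ≤ w}) := by
    rw [closure_pi_set]
    exact fun i _ => hy i
  refine map_mem_closure (f := fun z : ι → X =>
    Finset.univ.sup' Finset.univ_nonempty (fun i => |a i| • |z i|)) hf hy' fun z hz => ?_
  choose w hw hzw using fun i => hz i (Set.mem_univ i)
  obtain ⟨w', hw', hww'⟩ := exists_convexHull_ge ha hw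
  refine ⟨w', hw', ?_⟩
  have h0 : 0 ≤ Finset.univ.sup' Finset.univ_nonempty (fun i => |a i| • |z i|) :=
    le_trans (smul_nonneg (abs_nonneg _) (abs_nonneg _))
      (Finset.le_sup' (fun i => |a i| • |z i|) (Finset.mem_univ (Classical.arbitrary ι)))
  rw [abs_of_nonneg h0]
  refine le_trans (Finset.sup'_le _ _ fun i hi => ?_) hww'
  exact (smul_le_smul_of_nonneg_left (hzw i) (abs_nonneg _)).trans
    (Finset.le_sup' (fun i => |a i| • w i) hi)

theorem isLatticeDisc {T : E →L[ℝ] X} (hT : IsPInftyConvex p T) :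
    IsLatticeDisc (pConvexDisc p T) where
  zero_mem := by
    rw [← map_zero T]
    exact apply_mem T (by simp)
  convex := (convex_setOf_exists_mem_abs_le (convex_convexHull ℝ _)).closure
  solid := isSolid_closure fun _ ⟨w, hw, hxw⟩ _ hyx => ⟨w, hw, hyx.trans hxw⟩
  isClosed := isClosed_closure
  exists_bound := by
    obtain ⟨K, hK1, hK⟩ := hT
    refine ⟨K, fun x hx => mem_closedBall_zero_iff.1
      (subset_of_generators_subset (p := p) (T := T) ?_ (convex_closedBall 0 K) ?_
        Metric.isClosed_closedBall hx)⟩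
    · rintro _ ⟨ι, _, _, x, hx, rfl⟩
      rw [mem_closedBall_zero_iff]
      exact (hK.norm_sup'_le x).trans (mul_le_of_le_one_right (zero_le_one.trans hK1) hx)
    · intro x hx y hyx
      rw [mem_closedBall_zero_iff] at hx ⊢
      exact (norm_le_norm_of_abs_le_abs hyx).trans hx

/-- Write `x i = ‖x i‖ • b i` with `b i` in the disc, and apply `sup'_mem` with weights `r⁻¹ * ‖x
i‖`, `r` being the `ℓ_p`-norm of `(‖x i‖)`. -/
theorem isPInftyConvexWith_id {T : E →L[ℝ] X} (hB : IsLatticeDisc (pConvexDisc p T)) :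
    IsPInftyConvexWith p 1 (ContinuousLinearMap.id ℝ hB.Space) := by
  intro n x
  rw [one_mul, ellNorm_eq_finLpNorm]
  set r := finLpNorm p fun i => ‖x i‖ with hr
  have hr0 : 0 ≤ r := finLpNorm.nonneg _
  rw [IsLatticeDisc.Space.norm_le_iff hB _ hr0]
  have hsup := (IsLatticeDisc.Space.isClassC_inclL hB).latticeHomomorphism.map_sup'
    fun i => |x i|
  simp only [IsLatticeDisc.Space.inclL_apply, IsLatticeDisc.Space.incl_abs] at hsup
  simp only [ContinuousLinearMap.id_apply]
  rw [hsup]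
  choose b hb hbx using fun i => IsLatticeDisc.Space.incl_mem_norm_smul hB (x i)
  have hxr : ∀ i, ‖x i‖ ≤ r := fun i => by
    simpa using finLpNorm.abs_apply_le (p := p) (fun i => ‖x i‖) i
  have ha : finLpNorm p (fun i => r⁻¹ * ‖x i‖) ≤ 1 := by
    rw [finLpNorm.const_mul, abs_of_nonneg (inv_nonneg.2 hr0), ← hr]
    exact inv_mul_le_one
  refine ⟨_, sup'_mem ha hb, ?_⟩
  change r • _ = _
  rw [smul_sup'_of_nonneg hr0]
  congr 1
  ext1 i
  rw [← hbx i, abs_of_nonneg (mul_nonneg (inv_nonneg.2 hr0) (norm_nonneg _))]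
  change _ = |‖x i‖ • b i|
  rw [abs_real_smul, smul_smul, abs_of_nonneg (norm_nonneg (x i))]
  -- If `r = 0`, the weights degenerate, but then every `‖x i‖` vanishes.
  rcases hr0.eq_or_lt with h0 | h0
  · have := hxr i
    rw [← h0] at this
    rw [le_antisymm this (norm_nonneg _)]
    simp
  · rw [mul_inv_cancel_left₀ h0.ne']

/-- The factor `E → Y₀` of a `(p,∞)`-convex operator. -/
noncomputable def factor (T : E →L[ℝ] X) (hB : IsLatticeDisc (pConvexDisc p T)) :
    E →L[ℝ] hB.Space :=
  have hmem : ∀ x : E, T x ∈ (‖x‖ : ℝ) • pConvexDisc p T := fun x => by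
    rcases eq_or_ne x 0 with rfl | hx
    · exact ⟨0, hB.zero_mem, by simp⟩
    · refine ⟨T (‖x‖⁻¹ • x), apply_mem T ?_, ?_⟩
      · rw [norm_smul, norm_inv, norm_norm, inv_mul_cancel₀ (norm_ne_zero_iff.2 hx)]
      · change ‖x‖ • T _ = _
        rw [map_smul, smul_inv_smul₀ (norm_ne_zero_iff.2 hx)]
  LinearMap.mkContinuous
    (LinearMap.codRestrict hB.submodule T.toLinearMap fun x =>
      (IsLatticeDisc.Space.exists_incl_eq hB (norm_nonneg x) (hmem x)).choose_spec ▸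
        (IsLatticeDisc.Space.exists_incl_eq hB (norm_nonneg x) (hmem x)).choose.2 :
      E →ₗ[ℝ] hB.Space) 1 fun x => by
    rw [one_mul, IsLatticeDisc.Space.norm_le_iff hB _ (norm_nonneg x)]
    exact hmem x

theorem incl_factor (T : E →L[ℝ] X) (hB : IsLatticeDisc (pConvexDisc p T)) (x : E) :
    IsLatticeDisc.Space.inclL hB (factor T hB x) = T x := rfl

end pConvexDisc

section ClassC

variable {Y : Type*} [NormedAddCommGroup Y] [Lattice Y] [NormedSpace ℝ Y] [IsBanachLattice Y]
  {V : Y →L[ℝ] X}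

/-- Interval preservation lifts the positive and negative parts of `x` separately; the difference of
the lifts works. Thus `V` maps balls onto solid sets. -/
theorem IsClassC.exists_map_eq_of_abs_le (hV : IsClassC V) {x : X} {z : Y} (h : |x| ≤ |V z|) :
    ∃ y, V y = x ∧ |y| ≤ |z| := by
  have hz := hV.intervalPreserving.2 |z| (abs_nonneg z)
  rw [hV.latticeHomomorphism.map_abs] at hz
  have hpos : x ⊔ 0 ∈ V '' Set.Icc 0 |z| := by
    rw [hz]
    exact ⟨le_sup_right, (sup_le (le_abs_self x) (abs_nonneg x)).trans h⟩
  have hneg : -x ⊔ 0 ∈ V '' Set.Icc 0 |z| := by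
    rw [hz]
    exact ⟨le_sup_right, (sup_le (neg_le_abs x) (abs_nonneg x)).trans h⟩
  obtain ⟨a, ⟨ha0, ha⟩, hax⟩ := hpos
  obtain ⟨b, ⟨hb0, hb⟩, hbx⟩ := hneg
  have hy : V (a - b) = x := by
    rw [map_sub, hax, hbx]
    exact posPart_sub_negPart x
  refine ⟨a - b, hy, hV.le_of_map_le ?_⟩
  rwa [hV.latticeHomomorphism.map_abs, hV.latticeHomomorphism.map_abs, hy]

theorem pConvexDisc_subset_image [Fact (1 ≤ p)] (U : E →L[ℝ] Y)
    (hY : IsPInftyConvex p (ContinuousLinearMap.id ℝ Y)) (hV : IsClassC V) :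
    ∃ c : ℝ, 0 < c ∧ pConvexDisc p (V.comp U) ⊆ V '' Metric.closedBall 0 c := by
  obtain ⟨K, hK1, hK⟩ := hY
  have hK0 : 0 ≤ K := zero_le_one.trans hK1
  -- The `+ 1` gives a positive radius even if `U = 0`, so that closedness transfers from the unit
  -- ball by dilation.
  refine ⟨K * ‖U‖ + 1, by positivity, pConvexDisc.subset_of_generators_subset ?_
    ((convex_closedBall _ _).linear_image V.toLinearMap) ?_
    (hV.isClosed_image_closedBall (by positivity))⟩
  · rintro _ ⟨ι, _, _, x, hx, rfl⟩
    refine ⟨Finset.univ.sup' Finset.univ_nonempty fun i => |U (x i)|, ?_, ?_⟩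
    · rw [mem_closedBall_zero_iff]
      have h1 : finLpNorm p (fun i => ‖U (x i)‖) ≤ ‖U‖ := by
        refine (finLpNorm.mono (b := fun i => ‖U‖ * ‖x i‖) fun i => ?_).trans ?_
        · rw [abs_norm, abs_of_nonneg (by positivity)]
          exact U.le_opNorm _
        · rw [finLpNorm.const_mul, abs_norm]
          exact mul_le_of_le_one_right (norm_nonneg U) hx
      have h2 := hK.norm_sup'_le fun i => U (x i)
      have h3 := mul_le_mul_of_nonneg_left h1 hK0
      simp only [ContinuousLinearMap.id_apply] at h2
      linarith
    · rw [hV.latticeHomomorphism.map_sup']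
      simp only [hV.latticeHomomorphism.map_abs, ContinuousLinearMap.comp_apply]
  · rintro _ ⟨z, hz, rfl⟩ x hx
    obtain ⟨y, rfl, hyz⟩ := hV.exists_map_eq_of_abs_le hx
    refine ⟨y, ?_, rfl⟩
    rw [mem_closedBall_zero_iff] at hz ⊢
    exact (norm_le_norm_of_abs_le_abs hyz).trans hz

end ClassC

end ConvexFactorization

/-- Factorization of `(p,∞)`-convex operators. -/
theorem exists_pInftyConvex_factorization (p : ℝ≥0∞) [Fact (1 ≤ p)]
    {E : Type u} [NormedAddCommGroup E] [NormedSpace ℝ E]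
    {X : Type v} [NormedAddCommGroup X] [Lattice X] [NormedSpace ℝ X] [IsBanachLattice X]
    (T : E →L[ℝ] X) (hT : IsPInftyConvex p T) :
    ∃ (Y₀ : Type v) (_ : NormedAddCommGroup Y₀) (_ : Lattice Y₀) (_ : NormedSpace ℝ Y₀)
      (_ : IsBanachLattice Y₀) (U₀ : E →L[ℝ] Y₀) (V₀ : Y₀ →L[ℝ] X),
      IsPInftyConvexWith p 1 (ContinuousLinearMap.id ℝ Y₀) ∧
      IsClassC V₀ ∧
      T = V₀.comp U₀ ∧
      ∀ (Y : Type w) [NormedAddCommGroup Y] [Lattice Y] [NormedSpace ℝ Y] [IsBanachLattice Y]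
        (U : E →L[ℝ] Y) (V : Y →L[ℝ] X),
        IsPInftyConvex p (ContinuousLinearMap.id ℝ Y) → IsClassC V → T = V.comp U →
        ∃ φ : Y₀ →L[ℝ] Y, IsClassC φ ∧ U = φ.comp U₀ ∧ V₀ = V.comp φ := by
  have hB := pConvexDisc.isLatticeDisc hT
  have hC := IsLatticeDisc.Space.isClassC_inclL hB
  refine ⟨hB.Space, inferInstance, inferInstance, inferInstance, inferInstance,
    pConvexDisc.factor T hB, IsLatticeDisc.Space.inclL hB,
    pConvexDisc.isPInftyConvexWith_id hB, hC, rfl, ?_⟩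
  intro Y _ _ _ _ U V hY hV hTV
  obtain ⟨c, hc, hsub⟩ := pConvexDisc_subset_image U hY hV
  rw [← hTV, ← IsLatticeDisc.Space.inclL_image_closedBall hB] at hsub
  obtain ⟨φ, hφ, hφV⟩ := hV.exists_lift hC hsub
  refine ⟨φ, hφ, ContinuousLinearMap.ext fun x => hV.injective ?_, hφV⟩
  have h1 := DFunLike.congr_fun hTV x
  have h2 := DFunLike.congr_fun hφV (pConvexDisc.factor T hB x)
  rw [pConvexDisc.incl_factor] at h2
  exact h1.symm.trans h2

/-! ### Riesz decomposition -/

section RieszDecomposition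

variable {X : Type*} [AddCommGroup X] [Lattice X] [IsOrderedAddMonoid X]

theorem exists_abs_le_abs_sub_le {x a b : X} (ha : 0 ≤ a) (hb : 0 ≤ b) (h : |x| ≤ a + b) :
    ∃ u, |u| ≤ a ∧ |x - u| ≤ b := by
  obtain ⟨h1, h2⟩ := abs_le'.1 h
  -- `u` is the truncation of `x` to `[-a, a]`.
  refine ⟨(x ⊓ a) ⊔ -a, abs_le'.2 ⟨sup_le inf_le_right (neg_le_self ha), ?_⟩,
    abs_le'.2 ⟨?_, ?_⟩⟩
  · exact neg_le.1 le_sup_right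
  · rw [sub_le_comm]
    exact le_sup_of_le_left (le_inf (sub_le_self x hb) (sub_le_iff_le_add.2 h1))
  · rw [neg_sub, sub_le_iff_le_add']
    refine sup_le (inf_le_left.trans (le_add_of_nonneg_right hb)) ?_
    calc -a = -(a + b) + b := by abel
      _ ≤ x + b := add_le_add_left (neg_le.1 h2) b

/-- Greedy induction: `|x j|` takes `|x j| ⊓ a` out of `a` and the remainder out of `b`; what is
left still dominates the other terms. -/
theorem exists_sum_abs_le_sum_abs_sub_le {ι : Type*} (s : Finset ι) (x : ι → X) {a b : X}
    (ha : 0 ≤ a) (hb : 0 ≤ b) (h : ∑ i ∈ s, |x i| ≤ a + b) :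
    ∃ u : ι → X, ∑ i ∈ s, |u i| ≤ a ∧ ∑ i ∈ s, |x i - u i| ≤ b := by
  classical
  induction s using Finset.induction_on generalizing a b with
  | empty => exact ⟨0, by simpa using ha, by simpa using hb⟩
  | insert j s hj ih =>
    rw [Finset.sum_insert hj] at h
    have hs : 0 ≤ ∑ i ∈ s, |x i| := Finset.sum_nonneg fun i _ => abs_nonneg _
    have hxj : |x j| ≤ a + b := le_trans (le_add_of_nonneg_right hs) h
    have hα : 0 ≤ |x j| ⊓ a := le_inf (abs_nonneg _) ha
    have hβ : 0 ≤ |x j| - |x j| ⊓ a := sub_nonneg.2 inf_le_left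
    have hβb : |x j| - |x j| ⊓ a ≤ b := by
      rw [sub_le_comm]
      exact le_inf (sub_le_self _ hb) (sub_le_iff_le_add.2 hxj)
    obtain ⟨y, hy, hxy⟩ := exists_abs_le_abs_sub_le hα hβ
      (show |x j| ≤ _ by rw [add_sub_cancel])
    obtain ⟨u, hu, hxu⟩ := ih (a := a - |x j| ⊓ a) (b := b - (|x j| - |x j| ⊓ a))
      (sub_nonneg.2 inf_le_right) (sub_nonneg.2 hβb) (by
        have : a - |x j| ⊓ a + (b - (|x j| - |x j| ⊓ a)) = a + b - |x j| := by abel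
        rw [this]
        exact le_sub_iff_add_le'.2 h)
    have hne : ∀ i ∈ s, i ≠ j := fun i hi h => hj (h ▸ hi)
    refine ⟨Function.update u j y, ?_, ?_⟩
    · rw [Finset.sum_insert hj, Function.update_self,
        Finset.sum_congr rfl fun i hi => by rw [Function.update_of_ne (hne i hi)]]
      exact (add_le_add hy hu).trans_eq (by abel)
    · rw [Finset.sum_insert hj, Function.update_self,
        Finset.sum_congr rfl fun i hi => by rw [Function.update_of_ne (hne i hi)]]
      exact (add_le_add hxy hxu).trans_eq (by abel)

end RieszDecomposition

/-! ### Completion of a solid seminormed vector lattice -/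

/-- A seminormed vector lattice whose seminorm is solid. -/
class HasSolidSeminorm (Z : Type*) [SeminormedAddCommGroup Z] [Lattice Z] : Prop where
  solid : ∀ ⦃x y : Z⦄, |x| ≤ |y| → ‖x‖ ≤ ‖y‖

namespace LatticeCompletion

open UniformSpace

variable {Z : Type*} [SeminormedAddCommGroup Z] [Lattice Z] [IsOrderedAddMonoid Z]
  [HasSolidSeminorm Z]

theorem uniformContinuous₂_of_abs_sub_le {f : Z → Z → Z}
    (hf : ∀ a b c d : Z, |f a b - f c d| ≤ |a - c| + |b - d|) : UniformContinuous₂ f := by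
  refine LipschitzWith.uniformContinuous (K := 2) (LipschitzWith.of_dist_le_mul fun x y => ?_)
  have h : ‖f x.1 x.2 - f y.1 y.2‖ ≤ ‖x.1 - y.1‖ + ‖x.2 - y.2‖ := by
    have habs : ∀ z : Z, ‖|z|‖ ≤ ‖z‖ := fun z => HasSolidSeminorm.solid (abs_abs z).le
    refine le_trans (HasSolidSeminorm.solid ((hf _ _ _ _).trans (le_abs_self _))) ?_
    exact (norm_add_le _ _).trans (add_le_add (habs _) (habs _))
  rw [← dist_eq_norm, ← dist_eq_norm, ← dist_eq_norm] at h
  have h1 : dist x.1 y.1 ≤ dist x y := le_max_left _ _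
  have h2 : dist x.2 y.2 ≤ dist x y := le_max_right _ _
  change dist (f x.1 x.2) (f y.1 y.2) ≤ 2 * dist x y
  linarith

theorem uniformContinuous₂_sup : UniformContinuous₂ ((· ⊔ ·) : Z → Z → Z) :=
  uniformContinuous₂_of_abs_sub_le fun a b c d => by
    -- Change one argument at a time, passing through `c ⊔ b`.
    rw [← sub_add_sub_cancel _ (c ⊔ b)]
    refine (abs_add_le _ _).trans (add_le_add (abs_sup_sub_sup_le_abs _ _ _) ?_)
    rw [sup_comm c, sup_comm c]
    exact abs_sup_sub_sup_le_abs _ _ _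

theorem uniformContinuous₂_inf : UniformContinuous₂ ((· ⊓ ·) : Z → Z → Z) :=
  uniformContinuous₂_of_abs_sub_le fun a b c d => by
    rw [← sub_add_sub_cancel _ (c ⊓ b)]
    refine (abs_add_le _ _).trans (add_le_add (abs_inf_sub_inf_le_abs _ _ _) ?_)
    rw [inf_comm c, inf_comm c]
    exact abs_inf_sub_inf_le_abs _ _ _

noncomputable instance : Max (Completion Z) := ⟨Completion.map₂ (· ⊔ ·)⟩

noncomputable instance : Min (Completion Z) := ⟨Completion.map₂ (· ⊓ ·)⟩

theorem coe_sup (x y : Z) : ((x ⊔ y : Z) : Completion Z) = (x : Completion Z) ⊔ y :=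
  (Completion.map₂_coe_coe x y _ uniformContinuous₂_sup).symm

theorem coe_inf (x y : Z) : ((x ⊓ y : Z) : Completion Z) = (x : Completion Z) ⊓ y :=
  (Completion.map₂_coe_coe x y _ uniformContinuous₂_inf).symm

instance : ContinuousSup (Completion Z) :=
  ⟨Completion.continuous_map₂ continuous_fst continuous_snd⟩

instance : ContinuousInf (Completion Z) :=
  ⟨Completion.continuous_map₂ continuous_fst continuous_snd⟩

noncomputable instance : Lattice (Completion Z) :=
  Lattice.mk'
    (fun a b => Completion.induction_on₂ a b
      (isClosed_eq (continuous_fst.sup continuous_snd) (continuous_snd.sup continuous_fst))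
      fun x y => by rw [← coe_sup, ← coe_sup, sup_comm])
    (fun a b c => Completion.induction_on₃ a b c
      (isClosed_eq
        ((continuous_fst.sup (continuous_fst.comp continuous_snd)).sup
          (continuous_snd.comp continuous_snd))
        (continuous_fst.sup ((continuous_fst.comp continuous_snd).sup
          (continuous_snd.comp continuous_snd))))
      fun x y z => by rw [← coe_sup, ← coe_sup, ← coe_sup, ← coe_sup, sup_assoc])
    (fun a b => Completion.induction_on₂ a b
      (isClosed_eq (continuous_fst.inf continuous_snd) (continuous_snd.inf continuous_fst))
      fun x y => by rw [← coe_inf, ← coe_inf, inf_comm])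
    (fun a b c => Completion.induction_on₃ a b c
      (isClosed_eq
        ((continuous_fst.inf (continuous_fst.comp continuous_snd)).inf
          (continuous_snd.comp continuous_snd))
        (continuous_fst.inf ((continuous_fst.comp continuous_snd).inf
          (continuous_snd.comp continuous_snd))))
      fun x y z => by rw [← coe_inf, ← coe_inf, ← coe_inf, ← coe_inf, inf_assoc])
    (fun a b => Completion.induction_on₂ a b
      (isClosed_eq (continuous_fst.sup (continuous_fst.inf continuous_snd)) continuous_fst)
      fun x y => by rw [← coe_inf, ← coe_sup, sup_inf_self])
    (fun a b => Completion.induction_on₂ a b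
      (isClosed_eq (continuous_fst.inf (continuous_fst.sup continuous_snd)) continuous_fst)
      fun x y => by rw [← coe_sup, ← coe_inf, inf_sup_self])

theorem coe_abs (x : Z) : ((|x| : Z) : Completion Z) = |(x : Completion Z)| := by
  rw [abs, abs, ← Completion.coe_neg, ← coe_sup]

theorem continuous_abs' : Continuous fun x : Completion Z => |x| :=
  continuous_id.sup continuous_neg

theorem add_sup_completion (c a b : Completion Z) : c + (a ⊔ b) = (c + a) ⊔ (c + b) :=
  Completion.induction_on₃ c a b
    (isClosed_eq
      (continuous_fst.add ((continuous_fst.comp continuous_snd).sup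
        (continuous_snd.comp continuous_snd)))
      ((continuous_fst.add (continuous_fst.comp continuous_snd)).sup
        (continuous_fst.add (continuous_snd.comp continuous_snd))))
    fun x y z => by
      rw [← coe_sup, ← Completion.coe_add, ← Completion.coe_add, ← Completion.coe_add, ← coe_sup,
        add_sup]

instance : IsOrderedAddMonoid (Completion Z) where
  add_le_add_left a b h c := by
    rw [← sup_eq_right] at h ⊢
    rw [add_comm a, add_comm b, ← add_sup_completion, h]

theorem norm_abs_completion (a : Completion Z) : ‖|a|‖ = ‖a‖ :=
  Completion.induction_on a (isClosed_eq continuous_abs'.norm continuous_norm) fun x => by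
    rw [← coe_abs, Completion.norm_coe, Completion.norm_coe]
    exact le_antisymm (HasSolidSeminorm.solid (abs_abs x).le)
      (HasSolidSeminorm.solid (abs_abs x).ge)

/-- Solidity recast as an inequality for all pairs, hence a closed condition checkable on the dense
image of `Z`; the hypothesis `|a| ≤ |b|` itself need not pass to approximants. -/
theorem norm_abs_inf_abs_le (a b : Completion Z) : ‖|a| ⊓ |b|‖ ≤ ‖b‖ :=
  Completion.induction_on₂ a b
    (isClosed_le ((continuous_abs'.comp continuous_fst).inf
      (continuous_abs'.comp continuous_snd)).norm continuous_snd.norm)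
    fun x y => by
      rw [← coe_abs, ← coe_abs, ← coe_inf, Completion.norm_coe, Completion.norm_coe]
      refine HasSolidSeminorm.solid ?_
      rw [abs_of_nonneg (le_inf (abs_nonneg x) (abs_nonneg y))]
      exact inf_le_right

variable [NormedSpace ℝ Z] [IsOrderedModule ℝ Z]

theorem smul_sup_completion {r : ℝ} (hr : 0 ≤ r) (a b : Completion Z) :
    r • (a ⊔ b) = r • a ⊔ r • b :=
  Completion.induction_on₂ a b
    (isClosed_eq ((continuous_fst.sup continuous_snd).const_smul r)
      ((continuous_fst.const_smul r).sup (continuous_snd.const_smul r)))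
    fun x y => by
      rw [← coe_sup, ← Completion.coe_smul, ← Completion.coe_smul, ← Completion.coe_smul,
        ← coe_sup, smul_sup_of_nonneg hr]

theorem smul_le_smul_completion {r : ℝ} (hr : 0 ≤ r) {a b : Completion Z} (h : a ≤ b) :
    r • a ≤ r • b := by
  rw [← sup_eq_right] at h ⊢
  rw [← smul_sup_completion hr, h]

instance : IsBanachLattice (Completion Z) where
  solid x y h := by
    have := norm_abs_inf_abs_le x y
    rwa [inf_eq_left.2 h, norm_abs_completion] at this
  smul_le_smul_of_nonneg_left r hr x y h := smul_le_smul_completion hr h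
  smul_le_smul_of_nonneg_right x hx r s h := by
    have := smul_le_smul_completion (sub_nonneg.2 h) hx
    rwa [smul_zero, sub_smul, sub_nonneg] at this

end LatticeCompletion

/-- A vector lattice endowed with a solid seminorm. -/
def SolidSeminormSpace {X : Type*} [AddCommGroup X] [Lattice X] [Module ℝ X] (ρ : Seminorm ℝ X)
    (_ : ∀ x y : X, |x| ≤ |y| → ρ x ≤ ρ y) : Type _ := X

namespace SolidSeminormSpace

variable {X : Type*} [AddCommGroup X] [Lattice X] [Module ℝ X] {ρ : Seminorm ℝ X}
  {hρ : ∀ x y : X, |x| ≤ |y| → ρ x ≤ ρ y}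

noncomputable instance : SeminormedAddCommGroup (SolidSeminormSpace ρ hρ) :=
  ρ.toAddGroupSeminorm.toSeminormedAddCommGroup

noncomputable instance : Lattice (SolidSeminormSpace ρ hρ) := inferInstanceAs (Lattice X)

noncomputable instance : Module ℝ (SolidSeminormSpace ρ hρ) := inferInstanceAs (Module ℝ X)

noncomputable instance : NormedSpace ℝ (SolidSeminormSpace ρ hρ) where
  norm_smul_le c x := (map_smul_eq_mul ρ c x).le

instance [IsOrderedAddMonoid X] : IsOrderedAddMonoid (SolidSeminormSpace ρ hρ) :=
  inferInstanceAs (IsOrderedAddMonoid X)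

instance [IsOrderedModule ℝ X] : IsOrderedModule ℝ (SolidSeminormSpace ρ hρ) :=
  inferInstanceAs (IsOrderedModule ℝ X)

instance : HasSolidSeminorm (SolidSeminormSpace ρ hρ) := ⟨hρ⟩

/-- The identity map onto the seminormed lattice. -/
def of (ρ : Seminorm ℝ X) (hρ : ∀ x y : X, |x| ≤ |y| → ρ x ≤ ρ y) :
    X →ₗ[ℝ] SolidSeminormSpace ρ hρ := LinearMap.id

end SolidSeminormSpace

/-! ### The seminorm of a `(p,1)`-concave operator -/

section ConcaveSeminorm

variable {p : ℝ≥0∞} {E X : Type*} [NormedAddCommGroup E] [NormedSpace ℝ E]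
  [NormedAddCommGroup X] [Lattice X] [NormedSpace ℝ X]

/-- The supremum of `(∑ i, ‖T (z i)‖ ^ p) ^ (1 / p)` over finite families with
`∑ i, |z i| ≤ |x|`. -/
noncomputable def pConcaveGauge (p : ℝ≥0∞) (T : X →L[ℝ] E) (x : X) : ℝ :=
  sSup {r | ∃ (ι : Type) (_ : Fintype ι) (z : ι → X),
    ∑ i, |z i| ≤ |x| ∧ r = finLpNorm p (fun i => ‖T (z i)‖)}

namespace pConcaveGauge

variable [IsBanachLattice X] {T : X →L[ℝ] E}

theorem le_of_forall_le {x : X} {c : ℝ} (h : ∀ (ι : Type) [Fintype ι] (z : ι → X),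
    ∑ i, |z i| ≤ |x| → finLpNorm p (fun i => ‖T (z i)‖) ≤ c) : pConcaveGauge p T x ≤ c := by
  -- The empty family is admissible, so the set is nonempty.
  refine csSup_le ⟨_, Empty, inferInstance, fun _ => 0, by simp, rfl⟩ ?_
  rintro _ ⟨ι, _, z, hz, rfl⟩
  exact h ι z hz

theorem finLpNorm_le [Fact (1 ≤ p)] (hT : IsPOneConcave p T) {x : X} {ι : Type} [Fintype ι] {z : ι → X}
    (hz : ∑ i, |z i| ≤ |x|) : finLpNorm p (fun i => ‖T (z i)‖) ≤ pConcaveGauge p T x := by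
  refine le_csSup ?_ ⟨ι, inferInstance, z, hz, rfl⟩
  obtain ⟨K, hK1, hK⟩ := hT
  refine ⟨K * ‖x‖, ?_⟩
  rintro _ ⟨κ, _, y, hy, rfl⟩
  refine (hK.finLpNorm_le y).trans (mul_le_mul_of_nonneg_left ?_ (zero_le_one.trans hK1))
  refine norm_le_norm_of_abs_le_abs ?_
  rwa [abs_of_nonneg (Finset.sum_nonneg fun i _ => abs_nonneg (y i))]

theorem exists_lt {x : X} {c : ℝ} (h : c < pConcaveGauge p T x) :
    ∃ (ι : Type) (_ : Fintype ι) (z : ι → X),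
      ∑ i, |z i| ≤ |x| ∧ c < finLpNorm p (fun i => ‖T (z i)‖) := by
  by_contra! hcon
  exact h.not_ge (le_of_forall_le fun ι _ z hz => hcon ι _ z hz)

variable [hp : Fact (1 ≤ p)]

theorem le_mul_norm {K : ℝ} (hK0 : 0 ≤ K) (hK : IsPOneConcaveWith p K T) (x : X) :
    pConcaveGauge p T x ≤ K * ‖x‖ :=
  le_of_forall_le fun ι _ y hy => by
    refine (hK.finLpNorm_le y).trans (mul_le_mul_of_nonneg_left ?_ hK0)
    refine norm_le_norm_of_abs_le_abs ?_
    rwa [abs_of_nonneg (Finset.sum_nonneg fun i _ => abs_nonneg (y i))]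

theorem norm_apply_le (hT : IsPOneConcave p T) (x : X) : ‖T x‖ ≤ pConcaveGauge p T x := by
  have := finLpNorm_le hT (x := x) (z := fun _ : Unit => x) (by simp)
  rwa [finLpNorm.of_unique, abs_norm] at this

theorem nonneg (hT : IsPOneConcave p T) (x : X) : 0 ≤ pConcaveGauge p T x :=
  (norm_nonneg _).trans (norm_apply_le hT x)

theorem mono (hT : IsPOneConcave p T) (x y : X) (h : |x| ≤ |y|) :
    pConcaveGauge p T x ≤ pConcaveGauge p T y :=
  le_of_forall_le fun _ _ _ hz => finLpNorm_le hT (hz.trans h)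

/-- Riesz decomposition splits a family admissible for `x + y` into one for `x` and one for `y`;
Minkowski's inequality does the rest. -/
theorem add_le (hT : IsPOneConcave p T) (x y : X) :
    pConcaveGauge p T (x + y) ≤ pConcaveGauge p T x + pConcaveGauge p T y :=
  le_of_forall_le fun ι _ z hz => by
    obtain ⟨u, hu, hzu⟩ := exists_sum_abs_le_sum_abs_sub_le Finset.univ z (abs_nonneg x)
      (abs_nonneg y) (hz.trans (abs_add_le x y))
    refine le_trans ?_ (add_le_add (finLpNorm_le hT hu) (finLpNorm_le hT hzu))
    refine le_trans (finLpNorm.mono fun i => ?_) (finLpNorm.add_le _ _)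
    rw [abs_norm, abs_of_nonneg (by positivity), map_sub]
    exact norm_le_norm_add_norm_sub' _ _ |>.trans (by rw [add_comm, norm_sub_rev, add_comm])

theorem smul_le (hT : IsPOneConcave p T) (c : ℝ) (x : X) :
    pConcaveGauge p T (c • x) ≤ ‖c‖ * pConcaveGauge p T x :=
  le_of_forall_le fun ι _ z hz => by
    rw [abs_real_smul] at hz
    rcases eq_or_ne c 0 with rfl | hc
    · rw [abs_zero, zero_smul] at hz
      have hz0 : ∀ i, z i = 0 := fun i => eq_zero_of_abs_nonpos
        ((Finset.single_le_sum (f := fun i => |z i|) (fun i _ => abs_nonneg _)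
          (Finset.mem_univ i)).trans hz)
      have := finLpNorm.const_mul (p := p) 0 fun i => ‖T (z i)‖
      simp only [hz0, map_zero, norm_zero, mul_zero, abs_zero, zero_mul] at this ⊢
      exact this.le
    · have hc' : 0 < |c| := abs_pos.2 hc
      have h1 : ∑ i, |c⁻¹ • z i| ≤ |x| := by
        simp only [abs_real_smul]
        rw [← Finset.smul_sum, abs_inv]
        exact (inv_smul_le_iff_of_pos hc').2 hz
      have h2 := finLpNorm_le hT h1
      simp only [map_smul, norm_smul, finLpNorm.const_mul, abs_inv, abs_norm, norm_inv] at h2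
      rwa [inv_mul_le_iff₀ (norm_pos_iff.2 hc)] at h2

/-- Nearly optimal families for the `x i` concatenate to a family admissible for `∑ i, |x i|`. An
error `ε / (M + 1)` per index, with `M` the `ℓ_p`-norm of the constant 1, costs at most `ε` in
total. -/
theorem finLpNorm_gauge_le (hT : IsPOneConcave p T) {ι : Type} [Fintype ι] (x : ι → X) :
    finLpNorm p (fun i => pConcaveGauge p T (x i)) ≤ pConcaveGauge p T (∑ i, |x i|) := by
  set M := finLpNorm p (fun _ : ι => (1 : ℝ)) with hM
  have hM0 : 0 ≤ M := finLpNorm.nonneg _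
  refine le_of_forall_pos_le_add fun ε hε => ?_
  have hδ : 0 < ε / (M + 1) := by positivity
  choose κ hκ z hz hlt using fun i =>
    exists_lt (sub_lt_self (pConcaveGauge p T (x i)) hδ)
  have h1 : finLpNorm p (fun s : Σ i, κ i => ‖T (z s.1 s.2)‖) ≤
      pConcaveGauge p T (∑ i, |x i|) := by
    refine finLpNorm_le hT (z := fun s : Σ i, κ i => z s.1 s.2) ?_
    rw [Fintype.sum_sigma, abs_of_nonneg (Finset.sum_nonneg fun i _ => abs_nonneg (x i))]
    exact Finset.sum_le_sum fun i _ => hz i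
  rw [finLpNorm.sigma] at h1
  have h2 : finLpNorm p (fun i => pConcaveGauge p T (x i)) ≤
      finLpNorm p (fun i => finLpNorm p (fun k => ‖T (z i k)‖)) +
        finLpNorm p (fun _ : ι => ε / (M + 1) * 1) := by
    refine le_trans (finLpNorm.mono fun i => ?_) (finLpNorm.add_le _ _)
    rw [abs_of_nonneg (nonneg hT _)]
    refine le_trans ?_ (le_abs_self _)
    linarith [hlt i]
  rw [finLpNorm.const_mul, abs_of_pos hδ, ← hM] at h2
  have h3 : ε / (M + 1) * M ≤ ε := by
    rw [div_mul_eq_mul_div, div_le_iff₀ (by positivity)]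
    nlinarith
  linarith

/-- `pConcaveGauge` as a seminorm. -/
noncomputable def seminorm (hT : IsPOneConcave p T) : Seminorm ℝ X :=
  Seminorm.ofSMulLE (pConcaveGauge p T)
    (le_antisymm (by simpa using smul_le hT 0 0) (nonneg hT 0)) (add_le hT) (smul_le hT)

theorem seminorm_mono (hT : IsPOneConcave p T) (x y : X) (h : |x| ≤ |y|) :
    seminorm hT x ≤ seminorm hT y := mono hT x y h

/-- The domain of a `(p,1)`-concave operator `T`, seminormed by `pConcaveGauge p T`. -/
abbrev Space (hT : IsPOneConcave p T) : Type _ := SolidSeminormSpace (seminorm hT) (seminorm_mono hT)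

/-- A lattice homomorphism carries families admissible for `x` to families admissible for `U x`,
where concavity of `Y` applies. -/
theorem le_mul_norm_apply {Y : Type*} [NormedAddCommGroup Y] [Lattice Y] [NormedSpace ℝ Y]
    [IsBanachLattice Y] {U : X →L[ℝ] Y} (V : Y →L[ℝ] E)
    (hY : IsPOneConcave p (ContinuousLinearMap.id ℝ Y)) (hU : IsLatticeHomomorphism U) :
    ∃ C : ℝ, ∀ x, pConcaveGauge p (V.comp U) x ≤ C * ‖U x‖ := by
  obtain ⟨K, hK1, hK⟩ := hY
  refine ⟨‖V‖ * K, fun x => le_of_forall_le fun ι _ z hz => ?_⟩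
  have h1 : finLpNorm p (fun i => ‖V.comp U (z i)‖) ≤
      ‖V‖ * finLpNorm p (fun i => ‖U (z i)‖) := by
    refine le_trans (finLpNorm.mono fun i => ?_)
      ((finLpNorm.const_mul ‖V‖ fun i => ‖U (z i)‖).trans (by rw [abs_norm])).le
    rw [abs_norm, abs_of_nonneg (by positivity)]
    exact V.le_opNorm _
  have h2 := hK.finLpNorm_le fun i => U (z i)
  simp only [ContinuousLinearMap.id_apply] at h2
  have h3 : ‖∑ i, |U (z i)|‖ ≤ ‖U x‖ := by
    refine norm_le_norm_of_abs_le_abs ?_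
    rw [abs_of_nonneg (Finset.sum_nonneg fun i _ => abs_nonneg _)]
    simp only [← hU.map_abs]
    rw [← map_sum, ← sup_eq_right, ← (hU _ _).1, sup_eq_right.2 hz]
  calc _ ≤ ‖V‖ * finLpNorm p (fun i => ‖U (z i)‖) := h1
    _ ≤ ‖V‖ * (K * ‖U x‖) := mul_le_mul_of_nonneg_left
      (h2.trans (mul_le_mul_of_nonneg_left h3 (zero_le_one.trans hK1))) (norm_nonneg V)
    _ = ‖V‖ * K * ‖U x‖ := by ring

end pConcaveGauge

/-! ### Density arguments and the `(p,1)`-concave factorization -/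

theorem IsLatticeHomomorphism.of_denseRange {Y Z : Type*} [NormedAddCommGroup Y] [Lattice Y]
    [NormedSpace ℝ Y] [IsBanachLattice Y] [NormedAddCommGroup Z] [Lattice Z] [NormedSpace ℝ Z]
    [IsBanachLattice Z] {U : X →L[ℝ] Y} (hU : IsLatticeHomomorphism U) (hd : DenseRange U)
    {φ : Y →L[ℝ] Z} (h : IsLatticeHomomorphism (φ.comp U)) : IsLatticeHomomorphism φ := by
  intro a b
  constructor
  · refine hd.induction_on₂ (p := fun a b => φ (a ⊔ b) = φ a ⊔ φ b) ?_ (fun x y => ?_) a b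
    · exact isClosed_eq (φ.continuous.comp (continuous_fst.sup continuous_snd))
        ((φ.continuous.comp continuous_fst).sup (φ.continuous.comp continuous_snd))
    · rw [← (hU x y).1]
      exact (h x y).1
  · refine hd.induction_on₂ (p := fun a b => φ (a ⊓ b) = φ a ⊓ φ b) ?_ (fun x y => ?_) a b
    · exact isClosed_eq (φ.continuous.comp (continuous_fst.inf continuous_snd))
        ((φ.continuous.comp continuous_fst).inf (φ.continuous.comp continuous_snd))
    · rw [← (hU x y).2]
      exact (h x y).2

theorem IsPOneConcaveWith.id_completion [Fact (1 ≤ p)] {Z : Type*} [SeminormedAddCommGroup Z]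
    [Lattice Z] [IsOrderedAddMonoid Z] [HasSolidSeminorm Z] [NormedSpace ℝ Z] [IsOrderedModule ℝ Z]
    (h : ∀ (n : ℕ) (x : Fin (n + 1) → Z), finLpNorm p (fun i => ‖x i‖) ≤ ‖∑ i, |x i|‖) :
    IsPOneConcaveWith p 1 (ContinuousLinearMap.id ℝ (UniformSpace.Completion Z)) := by
  intro n x
  rw [one_mul, ellNorm_eq_finLpNorm]
  have hd : DenseRange (Pi.map fun _ : Fin (n + 1) => ((↑) : Z → UniformSpace.Completion Z)) :=
    DenseRange.piMap fun _ => UniformSpace.Completion.denseRange_coe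
  refine hd.induction_on
    (p := fun x => finLpNorm p (fun i => ‖x i‖) ≤ ‖∑ i, |x i|‖) x ?_ fun y => ?_
  · refine isClosed_le (finLpNorm.continuous fun i => (continuous_apply i).norm)
      (Continuous.norm (continuous_finsetSum _ fun i _ => ?_))
    exact LatticeCompletion.continuous_abs'.comp (continuous_apply i)
  · have hsum : ∑ i, |(y i : UniformSpace.Completion Z)| =
        ((∑ i, |y i| : Z) : UniformSpace.Completion Z) := by
      simp only [← LatticeCompletion.coe_abs]
      exact (map_sum (UniformSpace.Completion.toCompl : Z →+ UniformSpace.Completion Z) _ _).symm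
    simp only [Pi.map_apply]
    rw [hsum]
    simp only [UniformSpace.Completion.norm_coe]
    exact h n y

end ConcaveSeminorm

/-- Factorization of `(p,1)`-concave operators. -/
theorem exists_pOneConcave_factorization (p : ℝ≥0∞) [Fact (1 ≤ p)]
    {E : Type u} [NormedAddCommGroup E] [NormedSpace ℝ E] [CompleteSpace E]
    {X : Type v} [NormedAddCommGroup X] [Lattice X] [NormedSpace ℝ X] [IsBanachLattice X]
    (T : X →L[ℝ] E) (hT : IsPOneConcave p T) :
    ∃ (Y₀ : Type v) (_ : NormedAddCommGroup Y₀) (_ : Lattice Y₀) (_ : NormedSpace ℝ Y₀)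
      (_ : IsBanachLattice Y₀) (U₀ : X →L[ℝ] Y₀) (V₀ : Y₀ →L[ℝ] E),
      IsPOneConcaveWith p 1 (ContinuousLinearMap.id ℝ Y₀) ∧
      IsClassD U₀ ∧
      T = V₀.comp U₀ ∧
      ∀ (Y : Type w) [NormedAddCommGroup Y] [Lattice Y] [NormedSpace ℝ Y] [IsBanachLattice Y]
        (U : X →L[ℝ] Y) (V : Y →L[ℝ] E),
        IsPOneConcave p (ContinuousLinearMap.id ℝ Y) → IsClassD U → T = V.comp U →
        ∃ φ : Y →L[ℝ] Y₀, IsClassD φ ∧ U₀ = φ.comp U ∧ V₀.comp φ = V := by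
  let ι : X →ₗ[ℝ] (pConcaveGauge.Space hT) := SolidSeminormSpace.of _ (pConcaveGauge.seminorm_mono hT)
  have hι : ∀ x, ‖ι x‖ = pConcaveGauge p T x := fun x => rfl
  let j : X →ₗ[ℝ] UniformSpace.Completion (pConcaveGauge.Space hT) :=
    (UniformSpace.Completion.toComplL : (pConcaveGauge.Space hT) →L[ℝ] UniformSpace.Completion (pConcaveGauge.Space hT)).toLinearMap ∘ₗ ι
  have hj : ∀ x, j x = ((ι x : (pConcaveGauge.Space hT)) : UniformSpace.Completion (pConcaveGauge.Space hT)) := fun x => rfl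
  have hjn : ∀ x, ‖j x‖ = pConcaveGauge p T x := fun x => by
    rw [hj, UniformSpace.Completion.norm_coe, hι]
  obtain ⟨K, hK1, hK⟩ := id hT
  let U₀ : X →L[ℝ] UniformSpace.Completion (pConcaveGauge.Space hT) := j.mkContinuous K fun x => by
    rw [hjn]
    exact pConcaveGauge.le_mul_norm (zero_le_one.trans hK1) hK x
  have hU₀ : ∀ x, U₀ x = ((ι x : (pConcaveGauge.Space hT)) : UniformSpace.Completion (pConcaveGauge.Space hT)) := fun x => rfl
  have hjd : DenseRange j := UniformSpace.Completion.denseRange_coe (α := pConcaveGauge.Space hT)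
  have hUD : IsClassD U₀ :=
    ⟨fun x y => ⟨LatticeCompletion.coe_sup (Z := (pConcaveGauge.Space hT)) x y, LatticeCompletion.coe_inf (Z := (pConcaveGauge.Space hT)) x y⟩,
      hjd⟩
  have hTj : ∃ C, ∀ x, ‖T.toLinearMap x‖ ≤ C * ‖j x‖ := ⟨1, fun x => by
    rw [hjn, one_mul]
    exact pConcaveGauge.norm_apply_le hT x⟩
  let V₀ : UniformSpace.Completion (pConcaveGauge.Space hT) →L[ℝ] E := T.toLinearMap.extendOfNorm j
  have hV₀ : ∀ x, V₀ (U₀ x) = T x := LinearMap.extendOfNorm_eq hjd hTj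
  refine ⟨UniformSpace.Completion (pConcaveGauge.Space hT), inferInstance, inferInstance, inferInstance, inferInstance,
    U₀, V₀, ?_, hUD, ContinuousLinearMap.ext fun x => (hV₀ x).symm, ?_⟩
  · exact IsPOneConcaveWith.id_completion fun n x => pConcaveGauge.finLpNorm_gauge_le hT x
  · intro Y _ _ _ _ U V hY hU hTV
    have hjU : ∃ C, ∀ x, ‖j x‖ ≤ C * ‖U.toLinearMap x‖ := by
      obtain ⟨C, hC⟩ := pConcaveGauge.le_mul_norm_apply V hY hU.latticeHomomorphism
      refine ⟨C, fun x => ?_⟩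
      rw [hjn, hTV]
      exact hC x
    -- The bound `hjU` makes `U x ↦ j x` well defined and continuous on the dense range of `U`.
    let φ : Y →L[ℝ] UniformSpace.Completion (pConcaveGauge.Space hT) := j.extendOfNorm U.toLinearMap
    have hφ : ∀ x, φ (U x) = U₀ x := LinearMap.extendOfNorm_eq hU.denseRange hjU
    have hφU : U₀ = φ.comp U := ContinuousLinearMap.ext fun x => (hφ x).symm
    refine ⟨φ, ⟨?_, ?_⟩, hφU, ?_⟩
    · exact hU.latticeHomomorphism.of_denseRange hU.denseRange (hφU ▸ hUD.latticeHomomorphism)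
    · refine Dense.mono ?_ hUD.denseRange
      rintro _ ⟨x, rfl⟩
      exact ⟨U x, hφ x⟩
    · refine ContinuousLinearMap.coeFn_injective (hU.denseRange.equalizer
        (V₀.comp φ).continuous V.continuous (funext fun x => ?_))
      change V₀ (φ (U x)) = V (U x)
      rw [hφ, hV₀, hTV]
      rfl

theorem mainTheorem1 (p : ℝ≥0∞) (hp : 1 ≤ p)
    (E : Type u) [NormedAddCommGroup E] [NormedSpace ℝ E] [CompleteSpace E]
    (X : Type v) [NormedAddCommGroup X] [Lattice X] [NormedSpace ℝ X] [IsBanachLattice X] :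
    (∀ T : E →L[ℝ] X, IsPInftyConvex p T →
      ∃ (Y₀ : Type v) (_ : NormedAddCommGroup Y₀) (_ : Lattice Y₀) (_ : NormedSpace ℝ Y₀)
        (_ : IsBanachLattice Y₀) (U₀ : E →L[ℝ] Y₀) (V₀ : Y₀ →L[ℝ] X),
        IsPInftyConvexWith p 1 (ContinuousLinearMap.id ℝ Y₀) ∧
        IsClassC V₀ ∧
        T = V₀.comp U₀ ∧
        ∀ (Y : Type w) [NormedAddCommGroup Y] [Lattice Y] [NormedSpace ℝ Y] [IsBanachLattice Y]
          (U : E →L[ℝ] Y) (V : Y →L[ℝ] X),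
          IsPInftyConvex p (ContinuousLinearMap.id ℝ Y) → IsClassC V → T = V.comp U →
          ∃ φ : Y₀ →L[ℝ] Y, IsClassC φ ∧ U = φ.comp U₀ ∧ V₀ = V.comp φ) ∧
    (∀ T : X →L[ℝ] E, IsPOneConcave p T →
      ∃ (Y₀ : Type v) (_ : NormedAddCommGroup Y₀) (_ : Lattice Y₀) (_ : NormedSpace ℝ Y₀)
        (_ : IsBanachLattice Y₀) (U₀ : X →L[ℝ] Y₀) (V₀ : Y₀ →L[ℝ] E),
        IsPOneConcaveWith p 1 (ContinuousLinearMap.id ℝ Y₀) ∧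
        IsClassD U₀ ∧
        T = V₀.comp U₀ ∧
        ∀ (Y : Type w) [NormedAddCommGroup Y] [Lattice Y] [NormedSpace ℝ Y] [IsBanachLattice Y]
          (U : X →L[ℝ] Y) (V : Y →L[ℝ] E),
          IsPOneConcave p (ContinuousLinearMap.id ℝ Y) → IsClassD U → T = V.comp U →
          ∃ φ : Y →L[ℝ] Y₀, IsClassD φ ∧ U₀ = φ.comp U ∧ V₀.comp φ = V) := by
  have : Fact (1 ≤ p) := ⟨hp⟩
  exact ⟨exists_pInftyConvex_factorization p, exists_pOneConcave_factorization p⟩
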